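/- Let $0<\alpha\le 1$ and let $f:[0,1]\to(0,\infty)$ be $\alpha$-Lipschitzian, i.e. $|f(x)-f(y)|\le L|x-y|^\alpha$ for some constant $L$ and all $x,y\in[0,1]$. Put $D=\{(x,y)\in\mathbb R^2: 0\le x\le 1,\ 0\le y\le f(x)\}$, let $\lambda$ be Lebesgue measure on $\mathbb R^2$ and $c=1/\lambda(D)$. Let $K$ be a bounded probability density on $\mathbb R$ with support in a compact interval $[-A,A]$, piecewise $C^2$ with bounded first derivative. Let $(k_n)$ be a nondecreasing sequence of integers with $k_n\to\infty$ and $0<k_n<n$ for all large $n$, and let $(h_n)$ be a nonincreasing sequence of positive numbers with $h_n\to 0$. For a finite set $S\subset\mathbb R^2$ and $1\le r\le k_n$ let $U_{n,r}(S)=\max\{y:(x,y)\in S,\ x\in[(r-1)/k_n,\,r/k_n)\}$, with $\max\varnothing=0$, let $x_r=(r-\tfrac12)/k_n$, and define $$\hat f_n(x;S)=\frac1{k_n}\sum_{r=1}^{k_n}\frac1{h_n}K\!\left(\frac{x-x_r}{h_n}\right)\left(U_{n,r}(S)+\frac1{n-k_n}\sum_{s=1}^{k_n}U_{n,s}(S)\right).$$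 Let $Z_1,Z_2,\dots$ be independent random points uniformly distributed on $D$ and, for each $n$, let $N_{0,n}$ be a Poisson random variable with mean $n$ that is independent of the sequence $(Z_i)_{i\ge1}$. Put $\Sigma_n=\{Z_1,\dots,Z_n\}$ and $\Sigma_{0,n}=\{Z_1,\dots,Z_{N_{0,n}}\}$ (the latter is a Poisson point process with mean measure $nc\,\lambda\,1_D$), and let $\hat f_n(x)=\hat f_n(x;\Sigma_n)$ and $\hat f_{0,n}(x)=\hat f_n(x;\Sigma_{0,n})$. If $k_n=o(n/\log n)$, $h_nk_n\to\infty$ and $n=O(k_n^{1+\alpha})$, then for every $x\in(0,1)$ the difference $\hat f_n(x)-\hat f_{0,n}(x)$ is integrable and $$\frac{n h_n^{1/2}}{k_n^{1/2}}\;\mathbb E\left|\hat f_n(x)-\hat f_{0,n}(x)\right|\longrightarrow 0\qquad(n\to\infty).$$ -/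

import Mathlib

open MeasureTheory ProbabilityTheory Filter Topology Asymptotics
open scoped NNReal

noncomputable section

namespace BoundaryEstimation

/-- The planar set `D = {(x, y) : 0 ≤ x ≤ 1, 0 ≤ y ≤ f x}` lying below the graph of `f`. -/
def region (f : ℝ → ℝ) : Set (ℝ × ℝ) :=
  {p | p.1 ∈ Set.Icc (0 : ℝ) 1 ∧ 0 ≤ p.2 ∧ p.2 ≤ f p.1}

/-- The random set consisting of the first `m` points of the sequence `Z`
(which is indexed from `0`). -/
def firstPoints {Ω : Type*} (Z : ℕ → Ω → ℝ × ℝ) (m : ℕ) (ω : Ω) : Set (ℝ × ℝ) :=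
  {p | ∃ i < m, Z i ω = p}

/-- The cell `[(r - 1) / k, r / k)`, for `r = 1, …, k`. -/
def cell (k r : ℕ) : Set ℝ := Set.Ico (((r : ℝ) - 1) / k) ((r : ℝ) / k)

/-- The center of `cell k r`. -/
def cellCenter (k r : ℕ) : ℝ := ((r : ℝ) - 1 / 2) / k

/-- The largest ordinate of the points of `S` whose abscissa lies in `cell k r`.
It is applied to finite sets `S`, for which the supremum is a maximum; if no point of `S`
has its abscissa in the cell, the value is `sSup ∅ = 0`. -/
def cellMax (S : Set (ℝ × ℝ)) (k r : ℕ) : ℝ :=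
  sSup {y | ∃ p ∈ S, p.1 ∈ cell k r ∧ p.2 = y}

/-- The rescaled kernel `t ↦ K (t / h) / h`. -/
def scaledKernel (K : ℝ → ℝ) (h t : ℝ) : ℝ := 1 / h * K (t / h)

/-- The kernel estimator at `x` of the upper edge, with parameters `n`, `k`, `h`, computed from
the set of points `S`. -/
def estimator (K : ℝ → ℝ) (n k : ℕ) (h : ℝ) (S : Set (ℝ × ℝ)) (x : ℝ) : ℝ :=
  1 / (k : ℝ) * ∑ r ∈ Finset.Icc 1 k, scaledKernel K h (x - cellCenter k r) *
    (cellMax S k r + 1 / ((n : ℝ) - k) * ∑ s ∈ Finset.Icc 1 k, cellMax S k s)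

/-- `K` is a bounded probability density supported in a compact interval `[-A, A]`, piecewise
`C²` with bounded first derivative. Nothing is required at the finitely many break points, so
this covers in particular every such `K` that is differentiable on the whole line. -/
structure IsKernel (K : ℝ → ℝ) : Prop where
  nonneg : ∀ t, 0 ≤ K t
  integral_eq_one : ∫ t, K t = 1
  bounded : ∃ B, ∀ t, K t ≤ B
  support_subset : ∃ A, Function.support K ⊆ Set.Icc (-A) A
  piecewise : ∃ T : Set ℝ, T.Finite ∧ ContDiffOn ℝ 2 K Tᶜ ∧ ∃ C, ∀ t ∉ T, |deriv K t| ≤ C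

end BoundaryEstimation

end

namespace BoundaryEstimation

/-! Both samples are initial segments of one sequence `Z`, so each pair of cell maxima is a single
running maximum read at the times `n` and `N n`. When `N n ≥ n/2`, the two values differ by at most
the sum, over indices between `n` and `N n`, of the excess of the new height over the maximum of the
first `⌈n/2⌉` heights. Since `N n` is independent of `Z`, the expectation is at most `E|N n - n| ≤
√n` times a uniform bound on one expected excess. The event `N n < n/2` has probability at most
`4/n` by Chebyshev and costs at most `sup f`.

With `β = c/k` and `δ` bounding the oscillation of `f` on a cell, one excess over `m` points has
mean at most `1/(m²β) + δ/m + βδ²` (`lintegral_sub_runMax_le`, `lintegral_exp_mul_le`). The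
condition `n = O(k^(1+α))` gives `δ = O(k/n)`, so for `m` about `n/2` this is `O(k/n²)`.

The estimator is linear in the cell maxima, with nonnegative weights of bounded total. After
normalization the error is `O(√h (√(k/n) + 1/√k))`, hence `O(√h)`, which tends to 0. -/

/-! ### Moments and deviations of the Poisson law. -/

theorem hasSum_poisson_weights (r : ℝ) :
    HasSum (fun n : ℕ => Real.exp (-r) * r ^ n / (n.factorial : ℝ)) 1 := by
  have := (NormedSpace.expSeries_div_hasSum_exp r).mul_left (Real.exp (-r))
  simpa [mul_div_assoc, ← Real.exp_eq_exp_ℝ, ← Real.exp_add] using this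

theorem hasSum_poisson_mul_nat (r : ℝ) :
    HasSum (fun n : ℕ => Real.exp (-r) * r ^ n / (n.factorial : ℝ) * n) r := by
  have h0 := hasSum_poisson_weights r
  -- The term at 0 vanishes; after the shift, the factor `n + 1` cancels against `(n + 1)!`, leaving
  -- `r` times the Poisson weights.
  rw [← hasSum_nat_add_iff' 1]
  have := h0.mul_left r
  simp only [Finset.range_one, Finset.sum_singleton, Nat.cast_zero, mul_zero, sub_zero]
  rw [mul_one] at this
  refine this.congr_fun fun n => ?_
  rw [Nat.factorial_succ]
  push_cast
  have : (n.factorial : ℝ) ≠ 0 := by positivity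
  have : (n : ℝ) + 1 ≠ 0 := by positivity
  field_simp
  ring

theorem hasSum_poisson_mul_sq (r : ℝ) :
    HasSum (fun n : ℕ => Real.exp (-r) * r ^ n / (n.factorial : ℝ) * (n : ℝ) ^ 2) (r ^ 2 + r) := by
  have h0 := hasSum_poisson_weights r
  rw [← hasSum_nat_add_iff' 1]
  have := ((hasSum_poisson_mul_nat r).add h0).mul_left r
  simp only [Finset.range_one, Finset.sum_singleton, Nat.cast_zero, ne_eq, OfNat.ofNat_ne_zero,
    not_false_eq_true, zero_pow, mul_zero, sub_zero]
  rw [mul_add, mul_one, ← sq] at this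
  refine this.congr_fun fun n => ?_
  rw [Nat.factorial_succ]
  push_cast
  have : (n.factorial : ℝ) ≠ 0 := by positivity
  have : (n : ℝ) + 1 ≠ 0 := by positivity
  field_simp
  ring

theorem hasSum_poisson_mul_sub_sq (r : ℝ) :
    HasSum (fun n : ℕ => Real.exp (-r) * r ^ n / (n.factorial : ℝ) * ((n : ℝ) - r) ^ 2) r := by
  have h0 := hasSum_poisson_weights r
  have := ((hasSum_poisson_mul_sq r).sub ((hasSum_poisson_mul_nat r).mul_left (2 * r))).add
    (h0.mul_left (r ^ 2))
  rw [show r ^ 2 + r - 2 * r * r + r ^ 2 * 1 = r by ring] at this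
  exact this.congr_fun fun n => by ring

theorem lintegral_sub_sq_poissonMeasure (r : ℝ≥0) :
    ∫⁻ n, ENNReal.ofReal (((n : ℝ) - r) ^ 2) ∂poissonMeasure r = ENNReal.ofReal r := by
  have h := hasSum_poisson_mul_sub_sq (r : ℝ)
  rw [← ofReal_integral_eq_lintegral_ofReal, integral_poissonMeasure]
  · simp only [smul_eq_mul]
    rw [h.tsum_eq]
  · rw [integrable_poissonMeasure_iff]
    refine h.summable.congr fun n => ?_
    rw [Real.norm_of_nonneg (sq_nonneg _)]
  · exact Eventually.of_forall fun n => sq_nonneg _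

/-- The variance is `r`; the pointwise inequality `|t| ≤ t²/(2√r) + √r/2` replaces Cauchy–Schwarz.
-/
theorem lintegral_abs_sub_poissonMeasure_le {r : ℝ≥0} (hr : 0 < r) :
    ∫⁻ n, ENNReal.ofReal |(n : ℝ) - r| ∂poissonMeasure r ≤ ENNReal.ofReal √(r : ℝ) := by
  have hs : 0 < √(r : ℝ) := Real.sqrt_pos.2 hr
  have hss : √(r : ℝ) * √(r : ℝ) = r := Real.mul_self_sqrt r.2
  calc ∫⁻ n, ENNReal.ofReal |(n : ℝ) - r| ∂poissonMeasure r
      ≤ ∫⁻ n, (ENNReal.ofReal (1 / (2 * √(r : ℝ))) * ENNReal.ofReal (((n : ℝ) - r) ^ 2)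
          + ENNReal.ofReal (√(r : ℝ) / 2)) ∂poissonMeasure r := by
        refine lintegral_mono fun n => ?_
        rw [← ENNReal.ofReal_mul (by positivity), ← ENNReal.ofReal_add (by positivity)
          (by positivity)]
        refine ENNReal.ofReal_le_ofReal ?_
        rw [← sq_abs]
        have h1 : 1 / (2 * √(r : ℝ)) * |(n : ℝ) - r| ^ 2 + √(r : ℝ) / 2 - |(n : ℝ) - r|
          = (|(n : ℝ) - r| - √(r : ℝ)) ^ 2 / (2 * √(r : ℝ)) := by
          field_simp
          ring
        have h2 : 0 ≤ (|(n : ℝ) - r| - √(r : ℝ)) ^ 2 / (2 * √(r : ℝ)) := by positivity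
        linarith
    _ = ENNReal.ofReal √(r : ℝ) := by
        rw [lintegral_add_right _ measurable_const, lintegral_const_mul _ (by fun_prop),
          lintegral_sub_sq_poissonMeasure, lintegral_const, measure_univ, mul_one,
          ← ENNReal.ofReal_mul (by positivity), ← ENNReal.ofReal_add (by positivity)
          (by positivity)]
        congr 1
        field_simp
        nlinarith

/-- Chebyshev: variance `r` against a deviation of `r/2`. -/
theorem poissonMeasure_lt_half_le {r : ℝ≥0} (hr : 0 < r) :
    poissonMeasure r {n : ℕ | (n : ℝ) < r / 2} ≤ ENNReal.ofReal (4 / r) := by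
  have hr' : (0 : ℝ) < r := hr
  have hpos : 0 < ((r : ℝ) / 2) ^ 2 := by positivity
  have h := mul_meas_ge_le_lintegral (μ := poissonMeasure r)
    (f := fun n : ℕ => ENNReal.ofReal (((n : ℝ) - r) ^ 2)) (by fun_prop)
    (ENNReal.ofReal (((r : ℝ) / 2) ^ 2))
  rw [lintegral_sub_sq_poissonMeasure] at h
  have h4 : ENNReal.ofReal (4 / r) = ENNReal.ofReal r / ENNReal.ofReal (((r : ℝ) / 2) ^ 2) := by
    rw [← ENNReal.ofReal_div_of_pos hpos]
    congr 1
    field_simp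
    ring
  rw [h4, ENNReal.le_div_iff_mul_le (Or.inl (ENNReal.ofReal_pos.2 hpos).ne') (Or.inl ENNReal.ofReal_ne_top),
    mul_comm]
  refine le_trans (mul_le_mul_right (measure_mono fun n hn => ?_) _) h
  have hn' : (n : ℝ) < r / 2 := hn
  exact ENNReal.ofReal_le_ofReal (by nlinarith)

/-! ### Running maxima and cell maxima. -/

/-- The running maximum `max 0 (v 0) … (v (m - 1))` of a real sequence. -/
noncomputable def runMax (v : ℕ → ℝ) : ℕ → ℝ
  | 0 => 0
  | m + 1 => max (runMax v m) (v m)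

theorem runMax_mono (v : ℕ → ℝ) : Monotone (runMax v) :=
  monotone_nat_of_le_succ fun _ => le_max_left _ _

theorem runMax_nonneg (v : ℕ → ℝ) (m : ℕ) : 0 ≤ runMax v m :=
  runMax_mono v (Nat.zero_le m)

theorem runMax_le_iff {v : ℕ → ℝ} {m : ℕ} {y : ℝ} (hy : 0 ≤ y) :
    runMax v m ≤ y ↔ ∀ i < m, v i ≤ y := by
  induction m with
  | zero => simpa [runMax] using hy
  | succ m ih =>
    rw [runMax, max_le_iff, ih]
    constructor
    · rintro ⟨h1, h2⟩ i hi
      rcases Nat.lt_succ_iff_lt_or_eq.1 hi with h | rfl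
      exacts [h1 i h, h2]
    · exact fun h => ⟨fun i hi => h i (by omega), h m (by omega)⟩

theorem measurable_runMax {Ω : Type*} [MeasurableSpace Ω] {v : ℕ → Ω → ℝ}
    (hv : ∀ i, Measurable (v i)) (m : ℕ) : Measurable fun ω => runMax (fun i => v i ω) m := by
  induction m with
  | zero => exact measurable_const
  | succ m ih => exact ih.max (hv m)

/-- Each step raises the maximum by at most the excess over any earlier maximum. Freezing the
reference time `l` makes the summands independent of `m` and `m'`, so that the endpoints can later
be random. -/
theorem ofReal_runMax_sub_le (v : ℕ → ℝ) {l m m' : ℕ} (hl : l ≤ m) (hm : m ≤ m') :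
    ENNReal.ofReal (runMax v m' - runMax v m) ≤
      ∑ i ∈ Finset.Ico m m', ENNReal.ofReal (v i - runMax v l) := by
  induction m', hm using Nat.le_induction with
  | base => simp
  | succ j hj ih =>
    rw [Finset.sum_Ico_succ_top hj]
    have h1 : runMax v (j + 1) - runMax v m ≤
        (runMax v j - runMax v m) + max (v j - runMax v l) 0 := by
      have h2 : runMax v l ≤ runMax v j := runMax_mono v (hl.trans hj)
      rw [runMax]
      rcases le_total (runMax v j) (v j) with h | h
      · rw [max_eq_right h]
        have := le_max_left (v j - runMax v l) 0
        linarith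
      · rw [max_eq_left h]
        have := le_max_right (v j - runMax v l) 0
        linarith
    calc ENNReal.ofReal (runMax v (j + 1) - runMax v m)
        ≤ ENNReal.ofReal (runMax v j - runMax v m) + ENNReal.ofReal (max (v j - runMax v l) 0) :=
          (ENNReal.ofReal_le_ofReal h1).trans ENNReal.ofReal_add_le
      _ ≤ _ := by
          rw [ENNReal.ofReal_max, ENNReal.ofReal_zero, max_eq_left zero_le]
          gcongr

theorem ofReal_abs_runMax_sub_le (v : ℕ → ℝ) {l n m : ℕ} (hn : l ≤ n) (hm : l ≤ m) :
    ENNReal.ofReal |runMax v n - runMax v m| ≤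
      ∑ i ∈ Finset.Ico (min n m) (max n m), ENNReal.ofReal (v i - runMax v l) := by
  rcases le_total n m with h | h
  · rw [min_eq_left h, max_eq_right h, abs_sub_comm, abs_of_nonneg (sub_nonneg.2 (runMax_mono v h))]
    exact ofReal_runMax_sub_le v hn h
  · rw [min_eq_right h, max_eq_left h, abs_of_nonneg (sub_nonneg.2 (runMax_mono v h))]
    exact ofReal_runMax_sub_le v hm h

open Classical in
/-- The ordinate of `p` if its abscissa lies in `cell k r`, and `0` otherwise. -/
noncomputable def cellHeight (k r : ℕ) (p : ℝ × ℝ) : ℝ := if p.1 ∈ cell k r then p.2 else 0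

theorem measurable_cellHeight (k r : ℕ) : Measurable (cellHeight k r) :=
  Measurable.ite (measurable_fst measurableSet_Ico) measurable_snd measurable_const

/-- Points outside the cell count as height 0, which changes nothing because ordinates are
nonnegative and both maxima default to 0. -/
theorem cellMax_firstPoints {Ω : Type*} {Z : ℕ → Ω → ℝ × ℝ} {ω : Ω} (hω : ∀ i, 0 ≤ (Z i ω).2)
    (k r m : ℕ) :
    cellMax (firstPoints Z m ω) k r = runMax (fun i => cellHeight k r (Z i ω)) m := by
  have hnn : ∀ i, 0 ≤ cellHeight k r (Z i ω) := fun i => by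
    unfold cellHeight; split_ifs <;> simp [hω i]
  have hle : ∀ i < m, cellHeight k r (Z i ω) ≤ runMax (fun i => cellHeight k r (Z i ω)) m :=
    (runMax_le_iff (v := fun i => cellHeight k r (Z i ω)) (runMax_nonneg _ m)).1 le_rfl
  have hub : ∀ y ∈ {y | ∃ p ∈ firstPoints Z m ω, p.1 ∈ cell k r ∧ p.2 = y},
      y ≤ runMax (fun i => cellHeight k r (Z i ω)) m := by
    rintro y ⟨p, ⟨i, hi, rfl⟩, hc, rfl⟩
    have := hle i hi
    rwa [cellHeight, if_pos hc] at this
  apply le_antisymm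
  · exact Real.sSup_le hub (runMax_nonneg _ m)
  · have h0 : 0 ≤ cellMax (firstPoints Z m ω) k r := by
      apply Real.sSup_nonneg
      rintro y ⟨p, ⟨i, hi, rfl⟩, hc, rfl⟩
      exact hω i
    rw [runMax_le_iff h0]
    intro i hi
    by_cases hc : (Z i ω).1 ∈ cell k r
    · rw [cellHeight, if_pos hc]
      exact le_csSup ⟨_, hub⟩ ⟨Z i ω, ⟨i, hi, rfl⟩, hc, rfl⟩
    · rw [cellHeight, if_neg hc]
      exact h0

/-! ### Expected excess of a new observation. -/

/-- The expected excess of a new observation over the maximum of `m` earlier independent ones,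
bounded through the distribution functions. -/
theorem lintegral_sub_runMax_le {Ω : Type*} [MeasurableSpace Ω] {P : Measure Ω}
    [IsProbabilityMeasure P] {v : ℕ → Ω → ℝ} (hv : ∀ i, Measurable (v i)) (hind : iIndepFun v P)
    {G g : ℝ → ENNReal} (hG : ∀ i, ∀ y, 0 ≤ y → P {ω | v i ω ≤ y} ≤ G y)
    (hg : ∀ i, ∀ y, 0 ≤ y → P {ω | y < v i ω} ≤ g y) {m i : ℕ} (hi : m ≤ i) :
    ∫⁻ ω, ENNReal.ofReal (v i ω - runMax (fun j => v j ω) m) ∂P ≤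
      ∫⁻ y in Set.Ici 0, G y ^ m * g y := by
  have hU := measurable_runMax hv m
  set U : Ω → ℝ := fun ω => runMax (fun j => v j ω) m with hUdef
  -- The positive part of `v i - U` is the length of the section `[U, v i)`; Tonelli then integrates
  -- over the level `y` last.
  let S : Set (Ω × ℝ) := {p | U p.1 ≤ p.2 ∧ p.2 < v i p.1}
  have hS : MeasurableSet S :=
    (measurableSet_le (hU.comp measurable_fst) measurable_snd).inter
      (measurableSet_lt measurable_snd ((hv i).comp measurable_fst))
  have hswap := Measure.prod_apply (μ := P) (ν := volume.restrict (Set.Ici (0 : ℝ))) hS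
  have hswap' := Measure.prod_apply_symm (μ := P) (ν := volume.restrict (Set.Ici (0 : ℝ))) hS
  have h1 : ∀ ω, ENNReal.ofReal (v i ω - U ω) =
      (volume.restrict (Set.Ici (0 : ℝ))) (Prod.mk ω ⁻¹' S) := by
    intro ω
    have : Prod.mk ω ⁻¹' S = Set.Ico (U ω) (v i ω) := rfl
    rw [this, Measure.restrict_apply measurableSet_Ico, Set.inter_eq_left.2, Real.volume_Ico]
    exact fun y hy => (runMax_nonneg _ m).trans hy.1
  calc ∫⁻ ω, ENNReal.ofReal (v i ω - U ω) ∂P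
      = ∫⁻ y in Set.Ici 0, P ((fun ω => (ω, y)) ⁻¹' S) := by
        rw [← hswap', hswap]
        exact lintegral_congr h1
    _ ≤ ∫⁻ y in Set.Ici 0, G y ^ m * g y := by
        refine setLIntegral_mono' measurableSet_Ici fun y hy => ?_
        have hy : 0 ≤ y := hy
        -- At level `y` the event is that `v i` exceeds `y` and the first `m` values do not. As `m ≤
        -- i`, these are `m + 1` conditions on distinct indices, and independence factors them.
        let B : ℕ → Set ℝ := fun l => if l = i then Set.Ioi y else Set.Iic y
        have hB : ∀ l, MeasurableSet (B l) := fun l => by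
          dsimp only [B]; split_ifs
          exacts [measurableSet_Ioi, measurableSet_Iic]
        have hnot : i ∉ Finset.range m := by simpa using hi
        have hset : (fun ω => (ω, y)) ⁻¹' S = ⋂ l ∈ insert i (Finset.range m), v l ⁻¹' B l := by
          ext ω
          simp only [Set.mem_preimage, S, Set.mem_ofPred_eq, hUdef, runMax_le_iff hy,
            Finset.mem_insert, Set.iInter_iInter_eq_or_left, Set.mem_inter_iff, Set.mem_iInter,
            Finset.mem_range, B, if_true, Set.mem_Ioi]
          rw [and_comm]
          refine and_congr_right fun _ => forall₂_congr fun l hl => ?_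
          rw [if_neg (by omega)]
          rfl
        rw [hset, hind.measure_inter_preimage_eq_mul _ (fun l _ => hB l),
          Finset.prod_insert hnot, mul_comm]
        refine mul_le_mul' ?_ ?_
        · calc ∏ l ∈ Finset.range m, P (v l ⁻¹' B l) ≤ ∏ l ∈ Finset.range m, G y := by
                refine Finset.prod_le_prod' fun l hl => ?_
                have hl : l < m := Finset.mem_range.1 hl
                simp only [B, if_neg (show l ≠ i by omega)]
                exact hG l y hy
            _ = G y ^ m := by simp
        · simp only [B, if_true]
          exact hg i y hy

/-- Put `t = a - y`. For `t > 0` two Gamma integrals give `1/(m²β)` and `δ/m`; on `[-δ, 0]` the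
integrand is at most `βδ` over a length `δ`; below `-δ` it vanishes. -/
theorem lintegral_exp_mul_le {β δ : ℝ} (hβ : 0 < β) (hδ : 0 ≤ δ) (a : ℝ) {m : ℕ} (hm : 0 < m) :
    ∫⁻ y in Set.Ici 0, ENNReal.ofReal (Real.exp (-(β * max (a - y) 0))) ^ m *
        ENNReal.ofReal (β * (a + δ - y)) ≤
      ENNReal.ofReal (1 / (m ^ 2 * β) + δ / m + β * δ ^ 2) := by
  have hm' : (0 : ℝ) < m := by exact_mod_cast hm
  have hmβ : 0 < m * β := by positivity
  let F : ℝ → ENNReal := fun t =>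
    ENNReal.ofReal (Real.exp (-(β * max t 0))) ^ m * ENNReal.ofReal (β * (t + δ))
  -- The exponents `2 - 1` and `1 - 1` match the form of the Gamma integral.
  let H : ℝ → ℝ := fun t => β * (t ^ ((2 : ℝ) - 1) * Real.exp (-(m * β * t))) +
    β * δ * (t ^ ((1 : ℝ) - 1) * Real.exp (-(m * β * t)))
  have i2 : ∀ s : ℝ, 0 < s →
      IntegrableOn (fun t : ℝ => t ^ (s - 1) * Real.exp (-(m * β * t))) (Set.Ioi 0) := by
    intro s hs
    have := integrableOn_rpow_mul_exp_neg_mul_rpow (p := 1) (s := s - 1) (b := m * β)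
      (by linarith) one_pos hmβ
    simpa [neg_mul] using this
  have hHint : IntegrableOn H (Set.Ioi 0) :=
    ((i2 2 two_pos).const_mul β).add ((i2 1 one_pos).const_mul (β * δ))
  have hHval : ∫ t in Set.Ioi 0, H t = 1 / (m ^ 2 * β) + δ / m := by
    rw [integral_add ((i2 2 two_pos).const_mul β) ((i2 1 one_pos).const_mul (β * δ)),
      integral_const_mul, integral_const_mul, Real.integral_rpow_mul_exp_neg_mul_Ioi two_pos hmβ,
      Real.integral_rpow_mul_exp_neg_mul_Ioi one_pos hmβ, Real.Gamma_two, Real.Gamma_one]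
    simp only [Real.rpow_two, Real.rpow_one]
    field_simp
  have hF : ∀ t, F t ≤ (Set.Icc (-δ) 0).indicator (fun _ => ENNReal.ofReal (β * δ)) t +
      (Set.Ioi 0).indicator (fun t => ENNReal.ofReal (H t)) t := by
    intro t
    rcases lt_or_ge 0 t with ht | ht
    · rw [Set.indicator_of_mem (show t ∈ Set.Ioi 0 from ht)]
      refine le_trans (le_of_eq ?_) le_add_self
      simp only [F, H]
      rw [max_eq_left ht.le, ← ENNReal.ofReal_pow (Real.exp_pos _).le,
        ← ENNReal.ofReal_mul (by positivity), ← Real.exp_nat_mul]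
      congr 1
      have e1 : (2 : ℝ) - 1 = 1 := by norm_num
      rw [e1, sub_self, Real.rpow_one, Real.rpow_zero]
      rw [show (m : ℝ) * -(β * t) = -(m * β * t) by ring]
      ring
    · rcases lt_or_ge t (-δ) with h2 | h2
      · have : F t = 0 := by
          simp only [F]
          rw [ENNReal.ofReal_of_nonpos (p := β * (t + δ)), mul_zero]
          exact mul_nonpos_of_nonneg_of_nonpos hβ.le (by linarith)
        rw [this]
        exact zero_le
      · rw [Set.indicator_of_mem (show t ∈ Set.Icc (-δ) 0 from ⟨h2, ht⟩)]
        refine le_trans ?_ le_self_add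
        simp only [F]
        rw [max_eq_right ht, mul_zero, neg_zero, Real.exp_zero, ENNReal.ofReal_one, one_pow,
          one_mul]
        refine ENNReal.ofReal_le_ofReal (mul_le_mul_of_nonneg_left (by linarith) hβ.le)
  calc ∫⁻ y in Set.Ici 0, ENNReal.ofReal (Real.exp (-(β * max (a - y) 0))) ^ m *
        ENNReal.ofReal (β * (a + δ - y))
      = ∫⁻ y in Set.Ici 0, F (a - y) := by
        refine lintegral_congr fun y => ?_
        simp only [F]
        rw [show a + δ - y = a - y + δ by ring]
    _ ≤ ∫⁻ y, F (a - y) := setLIntegral_le_lintegral _ _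
    _ = ∫⁻ t, F t := lintegral_sub_left_eq_self F a
    _ ≤ ∫⁻ t, ((Set.Icc (-δ) 0).indicator (fun _ => ENNReal.ofReal (β * δ)) t +
        (Set.Ioi 0).indicator (fun t => ENNReal.ofReal (H t)) t) := lintegral_mono hF
    _ = ENNReal.ofReal (1 / (m ^ 2 * β) + δ / m + β * δ ^ 2) := by
        rw [lintegral_add_left (measurable_const.indicator measurableSet_Icc),
          lintegral_indicator measurableSet_Icc, lintegral_indicator measurableSet_Ioi,
          setLIntegral_const, Real.volume_Icc, ← ofReal_integral_eq_lintegral_ofReal hHint, hHval,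
          ← ENNReal.ofReal_mul (by positivity), ← ENNReal.ofReal_add (by
            rw [zero_sub, neg_neg]; positivity) (by positivity)]
        · congr 1
          ring
        · refine (ae_restrict_mem measurableSet_Ioi).mono fun t ht => ?_
          have ht : 0 < t := ht
          simp only [H, Pi.zero_apply]
          positivity

/-! ### Geometry of the region and of the cells. -/

theorem abs_sub_le_of_holderOnWith {f : ℝ → ℝ} {L α : ℝ≥0} {s : Set ℝ}
    (hf : HolderOnWith L α f s) {x y d : ℝ} (hx : x ∈ s) (hy : y ∈ s) (hd : |x - y| ≤ d) :
    |f x - f y| ≤ L * d ^ (α : ℝ) := by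
  have hd0 : 0 ≤ d := (abs_nonneg _).trans hd
  have h := hf.edist_le_of_le hx hy (d := ENNReal.ofReal d) (by
    rw [edist_dist, Real.dist_eq]; exact ENNReal.ofReal_le_ofReal hd)
  rw [edist_dist, Real.dist_eq, ENNReal.ofReal_rpow_of_nonneg hd0 α.coe_nonneg, ← ENNReal.ofReal_coe_nnreal,
    ← ENNReal.ofReal_mul L.coe_nonneg] at h
  exact (ENNReal.ofReal_le_ofReal_iff (by positivity)).1 h

theorem measurableSet_region {f : ℝ → ℝ} (hf : ContinuousOn f (Set.Icc 0 1)) :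
    MeasurableSet (region f) := by
  have h1 : IsClosed (Set.Icc (0 : ℝ) 1 ×ˢ Set.Ici (0 : ℝ)) := isClosed_Icc.prod isClosed_Ici
  have h2 : ContinuousOn (fun p : ℝ × ℝ => f p.1 - p.2) (Set.Icc (0 : ℝ) 1 ×ˢ Set.Ici (0 : ℝ)) :=
    (hf.comp continuousOn_fst fun p hp => hp.1).sub continuousOn_snd
  have h3 := h2.preimage_isClosed_of_isClosed h1 (isClosed_Ici (a := (0 : ℝ)))
  convert h3.measurableSet using 1
  ext p
  simp [region, and_assoc]

/-- Conditioning on a set of measure zero or infinity yields the zero measure, whereas the law of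
`X` has mass 1. -/
theorem volume_ne_zero_and_ne_top_of_isUniform {Ω : Type*} [MeasurableSpace Ω] {P : Measure Ω}
    [IsProbabilityMeasure P] {X : Ω → ℝ × ℝ} (hX : Measurable X) {s : Set (ℝ × ℝ)}
    (hu : pdf.IsUniform X s P volume) :
    volume s ≠ 0 ∧ volume s ≠ ⊤ := by
  have h1 : P.map X Set.univ = 1 := by
    rw [Measure.map_apply hX MeasurableSet.univ, Set.preimage_univ, measure_univ]
  rw [hu, cond_apply' MeasurableSet.univ, Set.inter_univ] at h1
  constructor <;> intro h <;> simp [h] at h1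

theorem cell_subset_Icc {k r : ℕ} (hr : r ∈ Finset.Icc 1 k) : cell k r ⊆ Set.Icc 0 1 := by
  obtain ⟨h1, h2⟩ := Finset.mem_Icc.1 hr
  have hk : (0 : ℝ) < k := by exact_mod_cast (by omega : 0 < k)
  have h1' : (1 : ℝ) ≤ r := by exact_mod_cast h1
  have h2' : (r : ℝ) ≤ k := by exact_mod_cast h2
  intro x hx
  have e1 : 0 ≤ ((r : ℝ) - 1) / k := div_nonneg (by linarith) hk.le
  have e2 : (r : ℝ) / k ≤ 1 := (div_le_one hk).2 h2'
  exact ⟨e1.trans hx.1, hx.2.le.trans e2⟩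

theorem cellCenter_mem_cell {k r : ℕ} (hr : r ∈ Finset.Icc 1 k) : cellCenter k r ∈ cell k r := by
  obtain ⟨h1, h2⟩ := Finset.mem_Icc.1 hr
  have hk : (0 : ℝ) < k := by exact_mod_cast (by omega : 0 < k)
  exact ⟨div_le_div_of_nonneg_right (by linarith) hk.le,
    div_lt_div_of_pos_right (by linarith) hk⟩

theorem abs_sub_le_of_mem_cell {k r : ℕ} {x y : ℝ} (hx : x ∈ cell k r) (hy : y ∈ cell k r) :
    |x - y| ≤ 1 / k := by
  have : (r : ℝ) / k - ((r : ℝ) - 1) / k = 1 / k := by ring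
  rw [abs_le]
  constructor <;> linarith [hx.1, hx.2, hy.1, hy.2]

theorem volume_cell_prod (k r : ℕ) (y b : ℝ) :
    volume (cell k r ×ˢ Set.Ioc y b) = ENNReal.ofReal (1 / k * (b - y)) := by
  rw [Measure.volume_eq_prod, Measure.prod_prod, cell, Real.volume_Ico, Real.volume_Ioc,
    ← ENNReal.ofReal_mul (by rw [← sub_div]; simp)]
  congr 1
  ring

/-! ### Tails of the cell heights. -/

section Tail

variable {Ω : Type*} [MeasurableSpace Ω] {P : Measure Ω} [IsProbabilityMeasure P] {f : ℝ → ℝ}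

theorem measure_lt_cellHeight {X : Ω → ℝ × ℝ} (hX : Measurable X)
    (hu : pdf.IsUniform X (region f) P volume) (k r : ℕ) {y : ℝ} (hy : 0 ≤ y) :
    P {ω | y < cellHeight k r (X ω)} =
      ENNReal.ofReal (volume (region f)).toReal⁻¹ *
        volume (region f ∩ {p | p.1 ∈ cell k r ∧ y < p.2}) := by
  obtain ⟨h0, ht⟩ := volume_ne_zero_and_ne_top_of_isUniform hX hu
  have hT : MeasurableSet {p : ℝ × ℝ | p.1 ∈ cell k r ∧ y < p.2} :=
    (measurable_fst measurableSet_Ico).inter (measurable_snd measurableSet_Ioi)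
  have hset : {ω | y < cellHeight k r (X ω)} = X ⁻¹' {p | p.1 ∈ cell k r ∧ y < p.2} := by
    ext ω
    change y < cellHeight k r (X ω) ↔ (X ω).1 ∈ cell k r ∧ y < (X ω).2
    unfold cellHeight
    -- Outside the cell the height is the default 0, which cannot exceed `y ≥ 0`.
    split_ifs with h
    · simp [h]
    · simp [h, hy]
  rw [hset, pdf.IsUniform.measure_preimage h0 ht hu hT, ENNReal.div_eq_inv_mul,
    ENNReal.ofReal_inv_of_pos (ENNReal.toReal_pos h0 ht), ENNReal.ofReal_toReal ht]

/-- The part of the region above level `y` over the cell lies in a rectangle of width `1/k` reaching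
up to `b`; the companion lower bound uses an inscribed rectangle. -/
theorem measure_lt_cellHeight_le {X : Ω → ℝ × ℝ} (hX : Measurable X)
    (hu : pdf.IsUniform X (region f) P volume) {k r : ℕ} {b : ℝ}
    (hb : ∀ x ∈ cell k r, f x ≤ b) {y : ℝ} (hy : 0 ≤ y) :
    P {ω | y < cellHeight k r (X ω)} ≤
      ENNReal.ofReal ((volume (region f)).toReal⁻¹ / k * (b - y)) := by
  rw [measure_lt_cellHeight hX hu k r hy, div_mul_eq_mul_div, ← mul_one_div, mul_assoc,
    mul_comm (b - y), ENNReal.ofReal_mul (by positivity), ← volume_cell_prod k r y b]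
  gcongr
  rintro p ⟨⟨_, _, h3⟩, h4, h5⟩
  exact ⟨h4, h5, h3.trans (hb _ h4)⟩

theorem le_measure_lt_cellHeight {X : Ω → ℝ × ℝ} (hX : Measurable X)
    (hu : pdf.IsUniform X (region f) P volume) {k r : ℕ} (hr : r ∈ Finset.Icc 1 k) {a : ℝ}
    (ha : ∀ x ∈ cell k r, a ≤ f x) {y : ℝ} (hy : 0 ≤ y) :
    ENNReal.ofReal ((volume (region f)).toReal⁻¹ / k * (a - y)) ≤
      P {ω | y < cellHeight k r (X ω)} := by
  rw [measure_lt_cellHeight hX hu k r hy, div_mul_eq_mul_div, ← mul_one_div, mul_assoc,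
    mul_comm (a - y), ENNReal.ofReal_mul (by positivity), ← volume_cell_prod k r y a]
  gcongr
  rintro p ⟨h4, h5, h6⟩
  exact ⟨⟨cell_subset_Icc hr h4, hy.trans h5.le, h6.trans (ha _ h4)⟩, h4, h5⟩

/-- Complement of the lower tail bound, then `1 - t ≤ exp (-t)`, so that `m`-th powers become a
single exponential. -/
theorem measure_cellHeight_le_le {X : Ω → ℝ × ℝ} (hX : Measurable X)
    (hu : pdf.IsUniform X (region f) P volume) {k r : ℕ} (hr : r ∈ Finset.Icc 1 k) {a : ℝ}
    (ha : ∀ x ∈ cell k r, a ≤ f x) {y : ℝ} (hy : 0 ≤ y) :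
    P {ω | cellHeight k r (X ω) ≤ y} ≤
      ENNReal.ofReal (Real.exp (-((volume (region f)).toReal⁻¹ / k * max (a - y) 0))) := by
  have hm : MeasurableSet {ω | y < cellHeight k r (X ω)} :=
    measurableSet_lt measurable_const ((measurable_cellHeight k r).comp hX)
  have hset : {ω | cellHeight k r (X ω) ≤ y} = {ω | y < cellHeight k r (X ω)}ᶜ := by
    ext ω; simp
  have hβ : 0 ≤ (volume (region f)).toReal⁻¹ / k := by positivity
  rw [hset, prob_compl_eq_one_sub hm]
  calc 1 - P {ω | y < cellHeight k r (X ω)}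
      ≤ 1 - ENNReal.ofReal ((volume (region f)).toReal⁻¹ / k * max (a - y) 0) := by
        refine tsub_le_tsub_left ?_ _
        rw [mul_max_of_nonneg _ _ hβ, mul_zero, ENNReal.ofReal_max, ENNReal.ofReal_zero,
          max_eq_left zero_le]
        exact le_measure_lt_cellHeight hX hu hr ha hy
    _ = ENNReal.ofReal (1 - (volume (region f)).toReal⁻¹ / k * max (a - y) 0) := by
        rw [← ENNReal.ofReal_one, ENNReal.ofReal_sub _ (by positivity)]
    _ ≤ _ := ENNReal.ofReal_le_ofReal (Real.one_sub_le_exp_neg _)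

theorem lintegral_cellHeight_sub_runMax_le {Z : ℕ → Ω → ℝ × ℝ} (hZ : ∀ i, Measurable (Z i))
    (hind : iIndepFun Z P) (hu : ∀ i, pdf.IsUniform (Z i) (region f) P volume)
    {k r : ℕ} (hr : r ∈ Finset.Icc 1 k) {a δ : ℝ} (hδ : 0 ≤ δ)
    (ha : ∀ x ∈ cell k r, a ≤ f x) (hb : ∀ x ∈ cell k r, f x ≤ a + δ)
    {m i : ℕ} (hm : 0 < m) (hi : m ≤ i) :
    ∫⁻ ω, ENNReal.ofReal (cellHeight k r (Z i ω) -
        runMax (fun j => cellHeight k r (Z j ω)) m) ∂P ≤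
      ENNReal.ofReal (1 / (m ^ 2 * ((volume (region f)).toReal⁻¹ / k)) + δ / m +
        (volume (region f)).toReal⁻¹ / k * δ ^ 2) := by
  obtain ⟨h0, ht⟩ := volume_ne_zero_and_ne_top_of_isUniform (hZ 0) (hu 0)
  have hk : (0 : ℝ) < k := by
    have := Finset.mem_Icc.1 hr
    exact_mod_cast (by omega : 0 < k)
  have hβ : 0 < (volume (region f)).toReal⁻¹ / k :=
    div_pos (inv_pos.2 (ENNReal.toReal_pos h0 ht)) hk
  refine le_trans ?_ (lintegral_exp_mul_le hβ hδ a hm)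
  exact lintegral_sub_runMax_le (v := fun i ω => cellHeight k r (Z i ω))
    (fun i => (measurable_cellHeight k r).comp (hZ i))
    (hind.comp (fun _ => cellHeight k r) fun _ => measurable_cellHeight k r)
    (fun i y hy => measure_cellHeight_le_le (hZ i) (hu i) hr ha hy)
    (fun i y hy => measure_lt_cellHeight_le (hZ i) (hu i) hb hy) hi

end Tail

/-! ### Fixed time against independent Poisson time. -/

section Coupling

variable {Ω : Type*} [MeasurableSpace Ω] {P : Measure Ω} [IsProbabilityMeasure P]

/-- Comparison of the running maximum at time `n` and at an independent Poisson time of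
mean `n`. -/
theorem lintegral_abs_runMax_sub_poisson_le {v : ℕ → Ω → ℝ} (hv : ∀ i, Measurable (v i))
    {n : ℕ} (hn : 0 < n) {N : Ω → ℕ} (hN : Measurable N)
    (hlaw : HasLaw N (poissonMeasure (n : ℝ≥0)) P) (hind : IndepFun N (fun ω i => v i ω) P)
    {F : ℝ} (hF : 0 ≤ F) (hvF : ∀ᵐ ω ∂P, ∀ i, v i ω ≤ F) {ε : ENNReal}
    (hε : ∀ i, ⌈(n : ℝ) / 2⌉₊ ≤ i →
      ∫⁻ ω, ENNReal.ofReal (v i ω - runMax (fun j => v j ω) ⌈(n : ℝ) / 2⌉₊) ∂P ≤ ε) :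
    ∫⁻ ω, ENNReal.ofReal |runMax (fun j => v j ω) n - runMax (fun j => v j ω) (N ω)| ∂P ≤
      ENNReal.ofReal √(n : ℝ) * ε + ENNReal.ofReal (4 / n) * ENNReal.ofReal F := by
  have hn' : (0 : ℝ) < n := by exact_mod_cast hn
  set l := ⌈(n : ℝ) / 2⌉₊ with hl
  have hln : l ≤ n := Nat.ceil_le.2 (by linarith)
  -- Indicator that `i` lies between `n` and `M`. The cut at `l` kills the indices where `hε` gives
  -- nothing, and has no effect once `M ≥ n/2`.
  let g : ℕ → ℕ → ENNReal := fun i M =>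
    (Finset.Ico (max l (min n M)) (max n M) : Set ℕ).indicator 1 i
  let W : ℕ → Ω → ENNReal := fun i ω => ENNReal.ofReal (v i ω - runMax (fun j => v j ω) l)
  have hW : ∀ i, Measurable (W i) := fun i => ((hv i).sub (measurable_runMax hv l)).ennreal_ofReal
  have hgm : ∀ i, Measurable fun ω => g i (N ω) := fun i => (measurable_of_countable (g i)).comp hN
  have hpt : ∀ᵐ ω ∂P,
      ENNReal.ofReal |runMax (fun j => v j ω) n - runMax (fun j => v j ω) (N ω)| ≤
        ∑' i, g i (N ω) * W i ω +
          {ω | (N ω : ℝ) < n / 2}.indicator (fun _ => ENNReal.ofReal F) ω := by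
    filter_upwards [hvF] with ω hω
    rcases lt_or_ge (N ω : ℝ) ((n : ℝ) / 2) with h | h
    · rw [Set.indicator_of_mem (show ω ∈ {ω | (N ω : ℝ) < n / 2} from h)]
      refine le_trans (ENNReal.ofReal_le_ofReal ?_) le_add_self
      have e1 : ∀ m, runMax (fun j => v j ω) m ≤ F := fun m =>
        (runMax_le_iff hF).2 fun i _ => hω i
      have e2 := runMax_nonneg (fun j => v j ω)
      rw [abs_le]
      constructor <;> linarith [e1 n, e1 (N ω), e2 n, e2 (N ω)]
    · have hlN : l ≤ N ω := Nat.ceil_le.2 h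
      refine le_trans ?_ le_self_add
      refine (ofReal_abs_runMax_sub_le (fun j => v j ω) hln hlN).trans ?_
      refine le_trans (le_of_eq ?_)
        (ENNReal.sum_le_tsum (Finset.Ico (min n (N ω)) (max n (N ω))))
      refine Finset.sum_congr rfl fun i hi => ?_
      have : g i (N ω) = 1 := by
        simp only [g]
        rw [max_eq_right (le_min hln hlN), Set.indicator_of_mem (by simpa using hi)]
        rfl
      rw [this, one_mul]
  have hgsum : ∀ M : ℕ, ∑' i, g i M ≤ ENNReal.ofReal |(M : ℝ) - n| := by
    intro M
    simp only [g]
    rw [← tsum_subtype, Finset.tsum_subtype' (Finset.Ico (max l (min n M)) (max n M)) (1 : ℕ → ENNReal)]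
    simp only [Pi.one_apply, Finset.sum_const, Nat.card_Ico, nsmul_eq_mul, mul_one]
    rw [← ENNReal.ofReal_natCast]
    refine ENNReal.ofReal_le_ofReal ?_
    have h1 : max n M - max l (min n M) ≤ max n M - min n M :=
      Nat.sub_le_sub_left (le_max_right _ _) _
    refine (Nat.cast_le.2 h1).trans ?_
    rcases le_total n M with h | h
    · rw [max_eq_right h, min_eq_left h, Nat.cast_sub h]
      exact le_abs_self _
    · rw [max_eq_left h, min_eq_right h, Nat.cast_sub h, abs_sub_comm]
      exact le_abs_self _
  -- `g i` depends on `N` alone and `W i` on the sequence alone, so the expectation of the product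
  -- factors.
  have hterm : ∀ i, ∫⁻ ω, g i (N ω) * W i ω ∂P ≤ (∫⁻ ω, g i (N ω) ∂P) * ε := by
    intro i
    have hWi : Measurable fun u : ℕ → ℝ => ENNReal.ofReal (u i - runMax u l) :=
      ((measurable_pi_apply i).sub
        (measurable_runMax (v := fun i (u : ℕ → ℝ) => u i) measurable_pi_apply l)).ennreal_ofReal
    have hi := hind.comp (measurable_of_countable (g i)) hWi
    have := lintegral_mul_eq_lintegral_mul_lintegral_of_indepFun (hgm i) (hW i) hi
    simp only [Pi.mul_apply] at this
    rw [this]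
    by_cases hli : l ≤ i
    · gcongr
      exact hε i hli
    · have h0 : ∀ ω, g i (N ω) = 0 := by
        intro ω
        simp only [g]
        rw [Set.indicator_of_notMem]
        simp only [Finset.coe_Ico, Set.mem_Ico, not_and]
        intro h
        exact absurd ((le_max_left _ _).trans h) hli
      simp [h0]
  calc ∫⁻ ω, ENNReal.ofReal |runMax (fun j => v j ω) n - runMax (fun j => v j ω) (N ω)| ∂P
      ≤ ∫⁻ ω, (∑' i, g i (N ω) * W i ω +
          {ω | (N ω : ℝ) < n / 2}.indicator (fun _ => ENNReal.ofReal F) ω) ∂P :=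
        lintegral_mono_ae hpt
    _ = (∑' i, ∫⁻ ω, g i (N ω) * W i ω ∂P) +
          P {ω | (N ω : ℝ) < n / 2} * ENNReal.ofReal F := by
        have hms : MeasurableSet {ω | (N ω : ℝ) < n / 2} :=
          measurableSet_lt ((measurable_of_countable _).comp hN) measurable_const
        rw [lintegral_add_right _ (measurable_const.indicator hms),
          lintegral_tsum (f := fun i ω => g i (N ω) * W i ω)
            fun i => ((hgm i).mul (hW i)).aemeasurable,
          lintegral_indicator hms, setLIntegral_const, mul_comm (ENNReal.ofReal F)]
    _ ≤ ENNReal.ofReal √(n : ℝ) * ε + ENNReal.ofReal (4 / n) * ENNReal.ofReal F := by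
        have hnn : (0 : ℝ≥0) < n := by exact_mod_cast hn
        gcongr
        · calc (∑' i, ∫⁻ ω, g i (N ω) * W i ω ∂P) ≤ ∑' i, (∫⁻ ω, g i (N ω) ∂P) * ε :=
                ENNReal.tsum_le_tsum hterm
            _ = (∫⁻ ω, ∑' i, g i (N ω) ∂P) * ε := by
                rw [ENNReal.tsum_mul_right, lintegral_tsum fun i => (hgm i).aemeasurable]
            _ ≤ (∫⁻ ω, ENNReal.ofReal |(N ω : ℝ) - n| ∂P) * ε := by
                gcongr with ω
                exact hgsum _
            _ ≤ ENNReal.ofReal √(n : ℝ) * ε := by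
                gcongr
                have h1 := lintegral_abs_sub_poissonMeasure_le hnn
                rw [← hlaw.map_eq, lintegral_map (measurable_of_countable _) hN] at h1
                simpa using h1
        · have h2 := poissonMeasure_lt_half_le hnn
          rw [← hlaw.map_eq, Measure.map_apply hN (Set.to_countable _).measurableSet] at h2
          simpa using h2

end Coupling

/-! ### Kernel sums and weights of the estimator. -/

theorem card_filter_abs_sub_cellCenter_le (k : ℕ) (hk : 0 < k) (x : ℝ) {ρ : ℝ} (hρ : 0 ≤ ρ) :
    (((Finset.Icc 1 k).filter fun r => |x - cellCenter k r| ≤ ρ).card : ℝ) ≤ 2 * ρ * k + 1 := by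
  have hk' : (0 : ℝ) < k := by exact_mod_cast hk
  set u : ℝ := k * (x - ρ) + 1 / 2 with hu
  set w : ℝ := k * (x + ρ) + 1 / 2 with hw
  have hle : ((Finset.Icc 1 k).filter fun r => |x - cellCenter k r| ≤ ρ).card ≤
      (Finset.Icc ⌈u⌉ ⌊w⌋).card := by
    refine Finset.card_le_card_of_injOn (fun r : ℕ => (r : ℤ)) ?_ (Nat.cast_injective.injOn)
    intro r hr
    obtain ⟨-, h⟩ := Finset.mem_filter.1 (Finset.mem_coe.1 hr)
    obtain ⟨h1, h2⟩ := abs_le.1 h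
    have hc : k * cellCenter k r = r - 1 / 2 := by
      rw [cellCenter]; field_simp
    rw [Finset.mem_coe, Finset.mem_Icc, Int.ceil_le, Int.le_floor]
    constructor
    · push_cast
      nlinarith
    · push_cast
      nlinarith
  refine (Nat.cast_le.2 hle).trans ?_
  rw [Int.card_Icc]
  have h1 := Int.floor_le w
  have h2 := Int.le_ceil u
  have h3 : ((⌊w⌋ + 1 - ⌈u⌉).toNat : ℝ) = ((max (⌊w⌋ + 1 - ⌈u⌉) 0 : ℤ) : ℝ) := by
    rw [← Int.toNat_eq_max]; norm_cast
  rw [h3]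
  push_cast
  refine max_le ?_ (by positivity)
  rw [hw] at h1
  rw [hu] at h2
  linarith

/-- At most `2|A|hk + 1` centers fall within the support, each contributing at most `B/h`. After
division by `k` the excess term is `B/(hk) ≤ B`. -/
theorem IsKernel.exists_sum_scaledKernel_le {K : ℝ → ℝ} (hK : IsKernel K) :
    ∃ C, 0 ≤ C ∧ ∀ (k : ℕ) (h x : ℝ), 0 < k → 0 < h → 1 ≤ h * k →
      1 / (k : ℝ) * ∑ r ∈ Finset.Icc 1 k, scaledKernel K h (x - cellCenter k r) ≤ C := by
  obtain ⟨B, hB⟩ := hK.bounded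
  obtain ⟨A, hA⟩ := hK.support_subset
  have hB0 : 0 ≤ B := (hK.nonneg 0).trans (hB 0)
  refine ⟨B * (2 * |A| + 1), by positivity, fun k h x hk hh hhk => ?_⟩
  have hk' : (0 : ℝ) < k := by exact_mod_cast hk
  have hterm : ∀ r ∈ Finset.Icc 1 k, scaledKernel K h (x - cellCenter k r) ≤
      if |x - cellCenter k r| ≤ |A| * h then B / h else 0 := by
    intro r _
    unfold scaledKernel
    split_ifs with hc
    · rw [one_div, inv_mul_eq_div]
      exact div_le_div_of_nonneg_right (hB _) hh.le
    · have : K ((x - cellCenter k r) / h) = 0 := by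
        by_contra hne
        have hmem := hA hne
        apply hc
        have h1 : |(x - cellCenter k r) / h| ≤ A := abs_le.2 hmem
        rw [abs_div, abs_of_pos hh, div_le_iff₀ hh] at h1
        exact h1.trans (mul_le_mul_of_nonneg_right (le_abs_self A) hh.le)
      rw [this, mul_zero]
  calc 1 / (k : ℝ) * ∑ r ∈ Finset.Icc 1 k, scaledKernel K h (x - cellCenter k r)
      ≤ 1 / (k : ℝ) * ((2 * (|A| * h) * k + 1) * (B / h)) := by
        gcongr
        refine (Finset.sum_le_sum hterm).trans ?_
        rw [← Finset.sum_filter, Finset.sum_const, nsmul_eq_mul]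
        gcongr
        exact card_filter_abs_sub_cellCenter_le k hk x (by positivity)
    _ = B * (2 * |A| + 1 / (h * k)) := by
        field_simp
    _ ≤ B * (2 * |A| + 1) := by
        gcongr
        rw [div_le_one (by positivity)]
        exact hhk

/-- The weight of the maximum over the `r`-th cell in the estimator. -/
noncomputable def cellWeight (K : ℝ → ℝ) (n k : ℕ) (h x : ℝ) (r : ℕ) : ℝ :=
  1 / (k : ℝ) * (scaledKernel K h (x - cellCenter k r) +
    1 / ((n : ℝ) - k) * ∑ s ∈ Finset.Icc 1 k, scaledKernel K h (x - cellCenter k s))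

theorem estimator_eq_sum_cellWeight (K : ℝ → ℝ) (n k : ℕ) (h : ℝ) (S : Set (ℝ × ℝ)) (x : ℝ) :
    estimator K n k h S x = ∑ r ∈ Finset.Icc 1 k, cellWeight K n k h x r * cellMax S k r := by
  unfold estimator cellWeight
  simp only [mul_add, add_mul, Finset.sum_add_distrib]
  congr 1
  · rw [Finset.mul_sum]
    exact Finset.sum_congr rfl fun r _ => by ring
  · rw [← Finset.sum_mul, ← Finset.mul_sum]
    ring

theorem IsKernel.cellWeight_nonneg {K : ℝ → ℝ} (hK : IsKernel K) {n k : ℕ} (hkn : k ≤ n) {h : ℝ}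
    (hh : 0 < h) (x : ℝ) (r : ℕ) : 0 ≤ cellWeight K n k h x r := by
  have h1 : (0 : ℝ) ≤ n - k := sub_nonneg.2 (by exact_mod_cast hkn)
  have h2 : ∀ t, 0 ≤ scaledKernel K h t := fun t => mul_nonneg (by positivity) (hK.nonneg _)
  have h3 : 0 ≤ ∑ s ∈ Finset.Icc 1 k, scaledKernel K h (x - cellCenter k s) :=
    Finset.sum_nonneg fun s _ => h2 _
  have := h2 (x - cellCenter k r)
  unfold cellWeight
  positivity

theorem sum_cellWeight (K : ℝ → ℝ) (n k : ℕ) (h x : ℝ) :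
    ∑ r ∈ Finset.Icc 1 k, cellWeight K n k h x r = (1 + k / ((n : ℝ) - k)) *
      (1 / (k : ℝ) * ∑ s ∈ Finset.Icc 1 k, scaledKernel K h (x - cellCenter k s)) := by
  unfold cellWeight
  rw [← Finset.mul_sum, Finset.sum_add_distrib, Finset.sum_const, Nat.card_Icc,
    Nat.add_sub_cancel, nsmul_eq_mul]
  ring

/-! ### Integrability at random times and reduction to single cells. -/

section Integrability

variable {Ω : Type*} [MeasurableSpace Ω] {P : Measure Ω}

theorem integrable_runMax_random_time [IsFiniteMeasure P] {v : ℕ → Ω → ℝ}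
    (hv : ∀ i, Measurable (v i)) {M : Ω → ℕ} (hM : Measurable M) {F : ℝ} (hF : 0 ≤ F)
    (hvF : ∀ᵐ ω ∂P, ∀ i, v i ω ≤ F) :
    Integrable (fun ω => runMax (fun j => v j ω) (M ω)) P := by
  have hm : Measurable fun p : Ω × ℕ => runMax (fun j => v j p.1) p.2 :=
    measurable_from_prod_countable_left fun m => measurable_runMax hv m
  refine Integrable.of_bound (hm.comp (measurable_id.prodMk hM)).aestronglyMeasurable F ?_
  filter_upwards [hvF] with ω hω
  change ‖runMax (fun j => v j ω) (M ω)‖ ≤ F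
  rw [Real.norm_of_nonneg (runMax_nonneg _ _)]
  exact (runMax_le_iff hF).2 fun i _ => hω i

theorem ae_forall_mem_region {f : ℝ → ℝ} (hf : ContinuousOn f (Set.Icc 0 1))
    {Z : ℕ → Ω → ℝ × ℝ} (hZ : ∀ i, Measurable (Z i))
    (hu : ∀ i, pdf.IsUniform (Z i) (region f) P volume) : ∀ᵐ ω ∂P, ∀ i, Z i ω ∈ region f := by
  rw [ae_all_iff]
  intro i
  have h : ∀ᵐ p ∂(P.map (Z i)), p ∈ region f := by
    rw [hu i]
    exact ae_cond_mem (measurableSet_region hf)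
  exact ae_of_ae_map (hZ i).aemeasurable h

theorem cellHeight_le_of_mem_region {f : ℝ → ℝ} {F : ℝ} (hF : 0 ≤ F)
    (hfF : ∀ x ∈ Set.Icc (0 : ℝ) 1, f x ≤ F) {p : ℝ × ℝ} (hp : p ∈ region f) (k r : ℕ) :
    cellHeight k r p ≤ F := by
  unfold cellHeight
  split_ifs
  exacts [hp.2.2.trans (hfF _ hp.1), hF]

theorem integrable_cellMax_random_time [IsFiniteMeasure P] {f : ℝ → ℝ} {F : ℝ} (hF : 0 ≤ F)
    (hfF : ∀ x ∈ Set.Icc (0 : ℝ) 1, f x ≤ F) {Z : ℕ → Ω → ℝ × ℝ} (hZ : ∀ i, Measurable (Z i))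
    (hreg : ∀ᵐ ω ∂P, ∀ i, Z i ω ∈ region f) {M : Ω → ℕ} (hM : Measurable M) (k r : ℕ) :
    Integrable (fun ω => cellMax (firstPoints Z (M ω) ω) k r) P := by
  refine (integrable_runMax_random_time (v := fun i ω => cellHeight k r (Z i ω))
    (fun i => (measurable_cellHeight k r).comp (hZ i)) hM hF ?_).congr ?_
  · filter_upwards [hreg] with ω hω i
    exact cellHeight_le_of_mem_region hF hfF (hω i) k r
  · filter_upwards [hreg] with ω hω
    exact (cellMax_firstPoints (fun i => (hω i).2.1) k r (M ω)).symm

theorem integrable_estimator_random_time {M : Ω → ℕ} {Z : ℕ → Ω → ℝ × ℝ} {k : ℕ}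
    (hint : ∀ r, Integrable (fun ω => cellMax (firstPoints Z (M ω) ω) k r) P)
    (K : ℝ → ℝ) (n : ℕ) (h x : ℝ) :
    Integrable (fun ω => estimator K n k h (firstPoints Z (M ω) ω) x) P := by
  simp only [estimator_eq_sum_cellWeight]
  exact integrable_finsetSum _ fun r _ => (hint r).const_mul _

theorem integral_abs_estimator_sub_le {Z : ℕ → Ω → ℝ × ℝ} {M M' : Ω → ℕ} {k : ℕ}
    (hM : ∀ r, Integrable (fun ω => cellMax (firstPoints Z (M ω) ω) k r) P)
    (hM' : ∀ r, Integrable (fun ω => cellMax (firstPoints Z (M' ω) ω) k r) P)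
    {K : ℝ → ℝ} (hK : IsKernel K) {n : ℕ} (hkn : k ≤ n) {h : ℝ} (hh : 0 < h) (x : ℝ) {b : ℝ}
    (hb : ∀ r ∈ Finset.Icc 1 k, ∫ ω, |cellMax (firstPoints Z (M ω) ω) k r -
      cellMax (firstPoints Z (M' ω) ω) k r| ∂P ≤ b) :
    ∫ ω, |estimator K n k h (firstPoints Z (M ω) ω) x -
        estimator K n k h (firstPoints Z (M' ω) ω) x| ∂P ≤
      (∑ r ∈ Finset.Icc 1 k, cellWeight K n k h x r) * b := by
  have hw := fun r => hK.cellWeight_nonneg hkn hh x r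
  have hd : ∀ r, Integrable (fun ω => |cellMax (firstPoints Z (M ω) ω) k r -
      cellMax (firstPoints Z (M' ω) ω) k r|) P := fun r => ((hM r).sub (hM' r)).abs
  calc ∫ ω, |estimator K n k h (firstPoints Z (M ω) ω) x -
        estimator K n k h (firstPoints Z (M' ω) ω) x| ∂P
      ≤ ∫ ω, ∑ r ∈ Finset.Icc 1 k, cellWeight K n k h x r *
          |cellMax (firstPoints Z (M ω) ω) k r - cellMax (firstPoints Z (M' ω) ω) k r| ∂P := by
        refine integral_mono ((integrable_estimator_random_time hM K n h x).sub
          (integrable_estimator_random_time hM' K n h x)).abs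
          (integrable_finsetSum _ fun r _ => (hd r).const_mul _) fun ω => ?_
        simp only [estimator_eq_sum_cellWeight, ← Finset.sum_sub_distrib, ← mul_sub]
        refine (Finset.abs_sum_le_sum_abs _ _).trans (le_of_eq ?_)
        exact Finset.sum_congr rfl fun r _ => by rw [abs_mul, abs_of_nonneg (hw r)]
    _ = ∑ r ∈ Finset.Icc 1 k, cellWeight K n k h x r *
          ∫ ω, |cellMax (firstPoints Z (M ω) ω) k r -
            cellMax (firstPoints Z (M' ω) ω) k r| ∂P := by
        rw [integral_finsetSum _ fun r _ => (hd r).const_mul _]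
        exact Finset.sum_congr rfl fun r _ => integral_const_mul _ _
    _ ≤ (∑ r ∈ Finset.Icc 1 k, cellWeight K n k h x r) * b := by
        rw [Finset.sum_mul]
        exact Finset.sum_le_sum fun r hr => mul_le_mul_of_nonneg_left (hb r hr) (hw r)

end Integrability

/-! ### Rates for one cell and conclusion. -/

theorem integral_abs_cellMax_sub_poisson_le {Ω : Type*} [MeasurableSpace Ω] {P : Measure Ω}
    [IsProbabilityMeasure P] {f : ℝ → ℝ} {α L : ℝ≥0} (hα0 : 0 < α)
    (hf : HolderOnWith L α f (Set.Icc (0 : ℝ) 1)) {F : ℝ} (hF : 0 ≤ F)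
    (hfF : ∀ x ∈ Set.Icc (0 : ℝ) 1, f x ≤ F) {Z : ℕ → Ω → ℝ × ℝ} (hZ : ∀ i, Measurable (Z i))
    (hind : iIndepFun Z P) (hu : ∀ i, pdf.IsUniform (Z i) (region f) P volume)
    {n : ℕ} (hn : 0 < n) {N : Ω → ℕ} (hN : Measurable N)
    (hlaw : HasLaw N (poissonMeasure (n : ℝ≥0)) P) (hNZ : IndepFun N (fun ω i => Z i ω) P)
    {k r : ℕ} (hr : r ∈ Finset.Icc 1 k) {δ : ℝ} (hδ : 2 * (L * (1 / (k : ℝ)) ^ (α : ℝ)) ≤ δ) :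
    ∫ ω, |cellMax (firstPoints Z n ω) k r - cellMax (firstPoints Z (N ω) ω) k r| ∂P ≤
      √(n : ℝ) * (1 / (((n : ℝ) / 2) ^ 2 * ((volume (region f)).toReal⁻¹ / k)) + δ / (n / 2) +
        (volume (region f)).toReal⁻¹ / k * δ ^ 2) + 4 / n * F := by
  have hn' : (0 : ℝ) < n := by exact_mod_cast hn
  have hk : (0 : ℝ) < k := by
    have := Finset.mem_Icc.1 hr
    exact_mod_cast (by omega : 0 < k)
  obtain ⟨h0, ht⟩ := volume_ne_zero_and_ne_top_of_isUniform (hZ 0) (hu 0)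
  have hc : 0 < (volume (region f)).toReal⁻¹ := inv_pos.2 (ENNReal.toReal_pos h0 ht)
  set c := (volume (region f)).toReal⁻¹ with hcdef
  have hδ0 : 0 ≤ δ := le_trans (by positivity) hδ
  have hreg := ae_forall_mem_region (hf.continuousOn hα0) hZ hu
  -- Comparison with the center keeps `f` within `δ/2` of its central value, so `a = f (cellCenter k
  -- r) - δ/2` serves as lower level and `a + δ` as upper level.
  have hosc : ∀ x ∈ cell k r, |f x - f (cellCenter k r)| ≤ δ / 2 := fun x hx =>
    (abs_sub_le_of_holderOnWith hf (cell_subset_Icc hr hx)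
      (cell_subset_Icc hr (cellCenter_mem_cell hr))
      (abs_sub_le_of_mem_cell hx (cellCenter_mem_cell hr))).trans (by linarith)
  have hm : 0 < ⌈(n : ℝ) / 2⌉₊ := Nat.ceil_pos.2 (by positivity)
  have hmn : (n : ℝ) / 2 ≤ (⌈(n : ℝ) / 2⌉₊ : ℝ) := Nat.le_ceil _
  set ε : ℝ := 1 / (((n : ℝ) / 2) ^ 2 * (c / k)) + δ / (n / 2) + c / k * δ ^ 2 with hε
  have hε0 : 0 ≤ ε := by positivity
  have key := lintegral_abs_runMax_sub_poisson_le (P := P)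
    (v := fun i ω => cellHeight k r (Z i ω))
    (fun i => (measurable_cellHeight k r).comp (hZ i)) hn hN hlaw
    (hNZ.comp (φ := id) (ψ := fun (z : ℕ → ℝ × ℝ) i => cellHeight k r (z i)) measurable_id
      (measurable_pi_lambda _ fun i => (measurable_cellHeight k r).comp (measurable_pi_apply i)))
    hF (hreg.mono fun ω hω i => cellHeight_le_of_mem_region hF hfF (hω i) k r)
    (ε := ENNReal.ofReal ε) (fun i hi => by
      refine (lintegral_cellHeight_sub_runMax_le hZ hind hu hr (a := f (cellCenter k r) - δ / 2)
        hδ0 (fun x hx => ?_) (fun x hx => ?_) hm hi).trans (ENNReal.ofReal_le_ofReal ?_)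
      · linarith [(abs_le.1 (hosc x hx)).1]
      · linarith [(abs_le.1 (hosc x hx)).2]
      · rw [hε]
        gcongr)
  rw [← ENNReal.ofReal_mul (by positivity), ← ENNReal.ofReal_mul (by positivity),
    ← ENNReal.ofReal_add (by positivity) (by positivity)] at key
  have hI := ((integrable_cellMax_random_time hF hfF hZ hreg (M := fun _ => n) measurable_const
    k r).sub (integrable_cellMax_random_time hF hfF hZ hreg hN k r)).abs
  rw [← ENNReal.ofReal_le_ofReal_iff (by positivity)]
  refine le_trans (le_of_eq ?_) key
  refine (ofReal_integral_eq_lintegral_ofReal hI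
    (Eventually.of_forall fun ω => abs_nonneg _)).trans (lintegral_congr_ae ?_)
  filter_upwards [hreg] with ω hω
  have e := cellMax_firstPoints (fun i => (hω i).2.1) k r
  simp only [Pi.sub_apply]
  rw [e, e]

/-- Here `B * k / n` stands for `δ`. Writing `n = u²`, `k = w²` makes the bound rational up to `√h`:
the excess terms carry `w/u ≤ 1` and the Chebyshev term carries `1/w ≤ 1`. -/
theorem normalized_bound_le {n k h c B C F : ℝ} (hk : 1 ≤ k) (hkn : k ≤ n) (hc : 0 < c)
    (hB : 0 ≤ B) (hC : 0 ≤ C) (hF : 0 ≤ F) :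
    n * √h / √k * (C * (√n * (1 / ((n / 2) ^ 2 * (c / k)) + B * k / n / (n / 2) +
      c / k * (B * k / n) ^ 2) + 4 / n * F)) ≤
      C * (4 / c + 2 * B + c * B ^ 2 + 4 * F) * √h := by
  have hk0 : 0 < k := by linarith
  have hn0 : 0 < n := by linarith
  obtain ⟨u, hu, rfl⟩ : ∃ u, 0 < u ∧ n = u ^ 2 :=
    ⟨√n, Real.sqrt_pos.2 hn0, (Real.sq_sqrt hn0.le).symm⟩
  obtain ⟨w, hw, rfl⟩ : ∃ w, 0 < w ∧ k = w ^ 2 :=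
    ⟨√k, Real.sqrt_pos.2 hk0, (Real.sq_sqrt hk0.le).symm⟩
  have hwu : w ≤ u := (sq_le_sq₀ hw.le hu.le).1 hkn
  have hw1 : 1 ≤ w := (one_le_sq_iff₀ hw.le).1 hk
  rw [Real.sqrt_sq hu.le, Real.sqrt_sq hw.le]
  have e : u ^ 2 * √h / w * (C * (u * (1 / ((u ^ 2 / 2) ^ 2 * (c / w ^ 2)) +
      B * w ^ 2 / u ^ 2 / (u ^ 2 / 2) + c / w ^ 2 * (B * w ^ 2 / u ^ 2) ^ 2) + 4 / u ^ 2 * F)) =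
      C * ((4 / c + 2 * B + c * B ^ 2) * (w / u) + 4 * F * (1 / w)) * √h := by
    field_simp
    ring
  rw [e]
  have h1 : w / u ≤ 1 := (div_le_one hu).2 hwu
  have h2 : 1 / w ≤ 1 := (div_le_one hw).2 hw1
  have h3 : (4 / c + 2 * B + c * B ^ 2) * (w / u) ≤ 4 / c + 2 * B + c * B ^ 2 :=
    mul_le_of_le_one_right (by positivity) h1
  have h4 : 4 * F * (1 / w) ≤ 4 * F := mul_le_of_le_one_right (by positivity) h2
  gcongr

theorem inv_rpow_le_of_le_rpow {n k C α : ℝ} (hk : 0 < k) (hn : 0 < n)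
    (h : n ≤ C * k ^ (1 + α)) : (1 / k) ^ α ≤ C * k / n := by
  rw [Real.rpow_add hk, Real.rpow_one] at h
  have hpos : 0 < k ^ α := Real.rpow_pos_of_pos hk α
  rw [one_div, Real.inv_rpow hk.le, inv_eq_one_div, div_le_div_iff₀ hpos hn]
  linarith

theorem eventually_le_half_of_isLittleO_div_log {k : ℕ → ℕ}
    (hk : (fun n : ℕ => (k n : ℝ)) =o[atTop] fun n : ℕ => (n : ℝ) / Real.log n) :
    ∀ᶠ n : ℕ in atTop, (k n : ℝ) ≤ n / 2 := by
  have h1 : ∀ᶠ n : ℕ in atTop, 1 ≤ Real.log n :=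
    (Real.tendsto_log_atTop.comp tendsto_natCast_atTop_atTop).eventually_ge_atTop 1
  filter_upwards [hk.bound (show (0 : ℝ) < 1 / 2 by norm_num), h1] with n h2 h3
  have hdiv : (n : ℝ) / Real.log n ≤ n := div_le_self (Nat.cast_nonneg n) h3
  rw [Real.norm_of_nonneg (Nat.cast_nonneg _), Real.norm_of_nonneg (by positivity)] at h2
  linarith

end BoundaryEstimation

theorem proposition1
    {Ω : Type*} [MeasurableSpace Ω] (P : Measure Ω) [IsProbabilityMeasure P]
    -- the boundary function: positive and `α`-Lipschitzian (Hölder of exponent `α`) on `[0, 1]`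
    (f : ℝ → ℝ) (α L : ℝ≥0) (hα0 : 0 < α) (hα1 : α ≤ 1)
    (hf_pos : ∀ x ∈ Set.Icc (0 : ℝ) 1, 0 < f x)
    (hf : HolderOnWith L α f (Set.Icc (0 : ℝ) 1))
    (K : ℝ → ℝ) (hK : BoundaryEstimation.IsKernel K)
    -- the numbers of cells and the bandwidths
    (k : ℕ → ℕ) (hk_mono : Monotone k) (hk_top : Tendsto k atTop atTop)
    (hk : ∀ᶠ n in atTop, 0 < k n ∧ k n < n)
    (h : ℕ → ℝ) (hh_pos : ∀ n, 0 < h n) (hh_anti : Antitone h) (hh_zero : Tendsto h atTop (𝓝 0))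
    -- the sample: independent points, uniformly distributed on the region below the graph of `f`
    (Z : ℕ → Ω → ℝ × ℝ) (hZ_meas : ∀ i, Measurable (Z i)) (hZ_indep : iIndepFun Z P)
    (hZ_unif : ∀ i, pdf.IsUniform (Z i) (BoundaryEstimation.region f) P volume)
    -- the number of points of the Poisson process: a Poisson variable of mean `n`,
    -- independent of the whole sequence `Z`
    (N : ℕ → Ω → ℕ) (hN_meas : ∀ n, Measurable (N n))
    (hN_law : ∀ n, HasLaw (N n) (poissonMeasure (n : ℝ≥0)) P)
    (hN_indep : ∀ n, IndepFun (N n) (fun ω i => Z i ω) P)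
    -- the growth conditions
    (hk_small : (fun n : ℕ => (k n : ℝ)) =o[atTop] fun n : ℕ => (n : ℝ) / Real.log n)
    (hhk : Tendsto (fun n => h n * k n) atTop atTop)
    (hk_large : (fun n : ℕ => (n : ℝ)) =O[atTop] fun n : ℕ => (k n : ℝ) ^ (1 + (α : ℝ)))
    (x : ℝ) (hx : x ∈ Set.Ioo (0 : ℝ) 1) :
    (∀ n, Integrable (fun ω =>
        BoundaryEstimation.estimator K n (k n) (h n)
            (BoundaryEstimation.firstPoints Z n ω) x -
          BoundaryEstimation.estimator K n (k n) (h n)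
            (BoundaryEstimation.firstPoints Z (N n ω) ω) x) P) ∧
    Tendsto (fun n : ℕ => (n : ℝ) * √(h n) / √(k n : ℝ) *
        ∫ ω, |BoundaryEstimation.estimator K n (k n) (h n)
            (BoundaryEstimation.firstPoints Z n ω) x -
          BoundaryEstimation.estimator K n (k n) (h n)
            (BoundaryEstimation.firstPoints Z (N n ω) ω) x| ∂P)
      atTop (𝓝 0) := by
  obtain ⟨F, hF, hfF⟩ : ∃ F, 0 ≤ F ∧ ∀ y ∈ Set.Icc (0 : ℝ) 1, f y ≤ F := by
    obtain ⟨F, hF⟩ := isCompact_Icc.exists_bound_of_continuousOn (hf.continuousOn hα0)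
    exact ⟨F, (norm_nonneg _).trans (hF 0 (by simp)), fun y hy => (le_abs_self _).trans (hF y hy)⟩
  have hreg := BoundaryEstimation.ae_forall_mem_region (hf.continuousOn hα0) hZ_meas hZ_unif
  have hint_det : ∀ n r, Integrable (fun ω =>
      BoundaryEstimation.cellMax (BoundaryEstimation.firstPoints Z n ω) (k n) r) P := fun n r =>
    BoundaryEstimation.integrable_cellMax_random_time hF hfF hZ_meas hreg (M := fun _ => n)
      measurable_const (k n) r
  have hint_poi : ∀ n r, Integrable (fun ω =>
      BoundaryEstimation.cellMax (BoundaryEstimation.firstPoints Z (N n ω) ω) (k n) r) P :=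
    fun n r => BoundaryEstimation.integrable_cellMax_random_time hF hfF hZ_meas hreg
      (hN_meas n) (k n) r
  refine ⟨fun n => (BoundaryEstimation.integrable_estimator_random_time (M := fun _ => n)
    (hint_det n) K n (h n) x).sub
    (BoundaryEstimation.integrable_estimator_random_time (hint_poi n) K n (h n) x), ?_⟩
  obtain ⟨C, hC, hCb⟩ := hK.exists_sum_scaledKernel_le
  obtain ⟨C₁, hC₁, hC₁b⟩ := hk_large.exists_nonneg
  obtain ⟨h0, ht⟩ :=
    BoundaryEstimation.volume_ne_zero_and_ne_top_of_isUniform (hZ_meas 0) (hZ_unif 0)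
  have hc : 0 < (volume (BoundaryEstimation.region f)).toReal⁻¹ :=
    inv_pos.2 (ENNReal.toReal_pos h0 ht)
  set c := (volume (BoundaryEstimation.region f)).toReal⁻¹ with hcdef
  have hlim : Tendsto (fun n => 2 * C * (4 / c + 2 * (2 * L * C₁) + c * (2 * L * C₁) ^ 2 + 4 * F) *
      √(h n)) atTop (𝓝 0) := by
    have := (hh_zero.sqrt).const_mul
      (2 * C * (4 / c + 2 * (2 * L * C₁) + c * (2 * L * C₁) ^ 2 + 4 * F))
    simpa using this
  refine squeeze_zero' (Eventually.of_forall fun n => ?_) ?_ hlim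
  · exact mul_nonneg (by positivity) (integral_nonneg fun ω => abs_nonneg _)
  filter_upwards [hk, hC₁b.bound, hhk.eventually_ge_atTop 1,
    BoundaryEstimation.eventually_le_half_of_isLittleO_div_log hk_small] with n hkn hgrow hhk1 hhalf
  obtain ⟨hk0, hkn⟩ := hkn
  have hn0 : 0 < n := hk0.trans hkn
  have hk0' : (0 : ℝ) < k n := by exact_mod_cast hk0
  have hn0' : (0 : ℝ) < n := by exact_mod_cast hn0
  rw [Real.norm_of_nonneg hn0'.le, Real.norm_of_nonneg (by positivity)] at hgrow
  have hδ : 2 * (L * (1 / (k n : ℝ)) ^ (α : ℝ)) ≤ 2 * L * C₁ * k n / n := by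
    have := BoundaryEstimation.inv_rpow_le_of_le_rpow hk0' hn0' hgrow
    calc 2 * (L * (1 / (k n : ℝ)) ^ (α : ℝ)) ≤ 2 * (L * (C₁ * k n / n)) := by gcongr
      _ = 2 * L * C₁ * k n / n := by ring
  have hcells := fun r hr => BoundaryEstimation.integral_abs_cellMax_sub_poisson_le hα0 hf hF hfF
    hZ_meas hZ_indep hZ_unif hn0 (hN_meas n) (hN_law n) (hN_indep n) (k := k n) (r := r) hr hδ
  have hest := BoundaryEstimation.integral_abs_estimator_sub_le (M := fun _ => n) (hint_det n)
    (hint_poi n) hK hkn.le (hh_pos n) x hcells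
  rw [← hcdef] at hest
  have hweights : ∑ r ∈ Finset.Icc 1 (k n), BoundaryEstimation.cellWeight K n (k n) (h n) x r ≤
      2 * C := by
    rw [BoundaryEstimation.sum_cellWeight]
    -- Since `k ≤ n/2`, the correction by the average of the maxima at most doubles the total
    -- weight, whence `2 * C`.
    have h1 : (k n : ℝ) / ((n : ℝ) - k n) ≤ 1 := (div_le_one (by linarith)).2 (by linarith)
    have h2 : 0 ≤ (k n : ℝ) / ((n : ℝ) - k n) := div_nonneg hk0'.le (by linarith)
    exact mul_le_mul (by linarith) (hCb (k n) (h n) x hk0 (hh_pos n) hhk1)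
      (mul_nonneg (by positivity) (Finset.sum_nonneg fun s _ =>
        mul_nonneg (one_div_nonneg.2 (hh_pos n).le) (hK.nonneg _))) (by norm_num)
  refine le_trans ?_ (BoundaryEstimation.normalized_bound_le (n := n) (k := k n) (h := h n)
    (c := c) (B := 2 * L * C₁) (C := 2 * C) (F := F) (by exact_mod_cast hk0)
    (by exact_mod_cast hkn.le) hc (by positivity) (by positivity) hF)
  refine mul_le_mul_of_nonneg_left (hest.trans ?_) (by positivity)
  exact mul_le_mul_of_nonneg_right hweights (by positivity)
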